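/- Let $K$ be a field, let $a>3$ be an integer and let $H_a=\langle a,a+1,2a+3\rangle$. Let $I_{H_a}\subset S=K[x,y,z]$ be the kernel of the $K$-algebra homomorphism $S\to K[t]$ with $x\mapsto t^{a}$, $y\mapsto t^{a+1}$, $z\mapsto t^{2a+3}$. For $0\ne f\in S$ let $f^*$ be the nonzero homogeneous component of $f$ of least degree, and let $I^*_{H_a}=(f^* : f\in I_{H_a},\ f\neq 0)$ be the defining ideal of the tangent cone of $K[H_a]$. Then: - if $a=3k$, then $I^*_{H_a}=(xz)+(y^{3i}z^{k-i} : 0\le i\le k)$; - if $a=3k+1$, then $I^*_{H_a}=(xz,\,z^{k+1})+(y^{3i+1}z^{k-i} : 0\le i\le k)$; - if $a=3k+2$, then $I^*_{H_a}=(xz,\,z^{k+1})+(y^{3i+2}z^{k-i} : 0\le i\le k)$. In each case the listed monomials form a minimal generating set of $I^*_{H_a}$ (no proper subset generates it), and the minimal number of generators of $I^*_{H_a}$ is $\mu(I^*_{H_a})=\left\lfloor \frac{a-1}{3}\right\rfloor+3$. -/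

import Mathlib

namespace TangentCone

open MvPolynomial

noncomputable section

/-- The relation ideal of `K[t ^ n₁, …, t ^ nᵣ]`: the kernel of the `K`-algebra homomorphism
`K[x₁, …, xᵣ] → K[t]`, `xᵢ ↦ t ^ nᵢ`. -/
def relationIdeal (K : Type*) [Field K] {r : ℕ} (n : Fin r → ℕ) :
    Ideal (MvPolynomial (Fin r) K) :=
  RingHom.ker (aeval (R := K) fun i => (Polynomial.X : Polynomial K) ^ n i)

/-- The initial degree of `f`: the least degree of a nonzero homogeneous component of `f`
(with value `0` at `f = 0`). -/
def initialDegree {K : Type*} [Field K] {r : ℕ} (f : MvPolynomial (Fin r) K) : ℕ :=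
  sInf {d : ℕ | homogeneousComponent d f ≠ 0}

/-- The initial form of `f`: its nonzero homogeneous component of least degree. -/
def initialForm {K : Type*} [Field K] {r : ℕ} (f : MvPolynomial (Fin r) K) :
    MvPolynomial (Fin r) K :=
  homogeneousComponent (initialDegree f) f

/-- The ideal generated by the initial forms of the nonzero elements of `I`. -/
def initialIdeal {K : Type*} [Field K] {r : ℕ} (I : Ideal (MvPolynomial (Fin r) K)) :
    Ideal (MvPolynomial (Fin r) K) :=
  Ideal.span {g | ∃ f ∈ I, f ≠ 0 ∧ g = initialForm f}

/-- `G` generates `I`, and no proper subset of `G` does. -/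
def IsMinimalGeneratingSet {R : Type*} [CommRing R] (I : Ideal R) (G : Set R) : Prop :=
  Ideal.span G = I ∧ ∀ G' : Set R, G' ⊂ G → Ideal.span G' ≠ I

/-- The tangent cone ideal of the semigroup generated by `a`, `a + 1`, `2 * a + 3`. -/
def shibutaTangentIdeal (K : Type*) [Field K] (a : ℕ) : Ideal (MvPolynomial (Fin 3) K) :=
  initialIdeal (relationIdeal K ![a, a + 1, 2 * a + 3])

end

end TangentCone

namespace TangentCone

open MvPolynomial Cardinal

/-! ### Monomial ideals generated by an antichain -/

section MonomialIdeal

variable {K σ ι : Type*} [Field K]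

/-! Truncated subtraction unifies the three cases: the generators are `x z` and `y ^ (a - 3j) z ^ j`
for `j ≤ ⌈a/3⌉`. Each is the initial form of a binomial relation. Conversely, `x^p y^q z^j` has
weight `a(p+q+2j) + (q+3j)`. Off the monomial ideal, `q+3j < a` is the remainder mod `a`, and `p =
0` or `j = 0`; then no other monomial of the same weight has degree at least `p+q+j`
(`eq_of_weight_eq_of_degree_le`). Terms of a relation cancel within each weight, so such a monomial
never occurs in an initial form. The exponents form an antichain, which gives minimality and the
number of generators. -/

lemma mem_span_range_monomial {e : ι → σ →₀ ℕ} {f : MvPolynomial σ K} :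
    f ∈ Ideal.span (Set.range fun i => monomial (e i) (1 : K)) ↔
      ∀ u ∈ f.support, ∃ i, e i ≤ u := by
  have h : (Set.range fun i => monomial (e i) (1 : K)) =
      (fun s => monomial s (1 : K)) '' Set.range e := by
    rw [← Set.range_comp]; rfl
  rw [h, mem_ideal_span_monomial_image]
  simp

/-- On an ideal generated by an antichain of monomials, the coefficient at a generating exponent
is semilinear along the constant coefficient. -/
lemma coeff_mul_of_mem_span_monomial {e : ι → σ →₀ ℕ} (he : ∀ i j, e i ≤ e j → i = j)
    {f : MvPolynomial σ K}
    (hf : f ∈ Ideal.span (Set.range fun i => monomial (e i) (1 : K)))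
    (s : MvPolynomial σ K) (i : ι) :
    coeff (e i) (s * f) = coeff 0 s * coeff (e i) f := by
  classical
  rw [coeff_mul, Finset.sum_eq_single (0, e i)]
  · rintro ⟨u, v⟩ huv hne
    rw [Finset.HasAntidiagonal.mem_antidiagonal] at huv
    by_contra h
    obtain ⟨j, hj⟩ := mem_span_range_monomial.1 hf v (mem_support_iff.2 (right_ne_zero_of_mul h))
    have hv : v ≤ e i := huv ▸ le_add_self
    obtain rfl := he j i (hj.trans hv)
    obtain rfl : v = e j := le_antisymm hv hj
    exact hne (by simpa using huv)
  · intro h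
    simp at h

/-- Any generating set of an ideal generated by an antichain of monomials has at least as many
elements as the antichain. -/
lemma card_le_of_span_eq_span_monomial [Fintype ι] {e : ι → σ →₀ ℕ}
    (he : ∀ i j, e i ≤ e j → i = j) {T : Set (MvPolynomial σ K)}
    (hT : Ideal.span T = Ideal.span (Set.range fun i => monomial (e i) (1 : K))) :
    (Fintype.card ι : Cardinal) ≤ #T := by
  classical
  -- On the ideal `I`, `φ` plays the role of `I → I/𝔪I`: multipliers act through their constant
  -- term, so `φ '' T` must span `ι → K`.
  let φ : MvPolynomial σ K →ₗ[K] (ι → K) := LinearMap.pi fun i => lcoeff K (e i)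
  have hφ : ∀ f i, φ f i = coeff (e i) f := fun _ _ => rfl
  have hmem : ∀ f ∈ Ideal.span T, φ f ∈ Submodule.span K (φ '' T) := by
    intro f hf
    induction hf using Submodule.span_induction with
    | mem x hx => exact Submodule.subset_span ⟨x, hx, rfl⟩
    | zero => simp
    | add x y _ _ hx hy => rw [map_add]; exact add_mem hx hy
    | smul s x hx ih =>
      have : φ (s • x) = coeff 0 s • φ x := by
        funext i
        exact coeff_mul_of_mem_span_monomial he (hT ▸ hx) s i
      rw [this]
      exact Submodule.smul_mem _ _ ih
  have htop : Submodule.span K (φ '' T) = ⊤ := by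
    rw [eq_top_iff, ← (Pi.basisFun K ι).span_eq, Submodule.span_le]
    rintro _ ⟨i, rfl⟩
    have hi : φ (monomial (e i) 1) = Pi.basisFun K ι i := by
      funext j
      have : e i = e j ↔ j = i := ⟨fun h => (he i j h.le).symm, fun h => h ▸ rfl⟩
      rw [hφ, coeff_monomial, Pi.basisFun_apply, Pi.single_apply]
      simp only [this]
    rw [← hi]
    exact hmem _ (hT ▸ Ideal.subset_span ⟨i, rfl⟩)
  have h := rank_span_le (R := K) (φ '' T)
  rw [htop, rank_top, rank_fun'] at h
  have h' := (lift_le.2 h).trans (mk_image_le_lift (f := φ) (s := T))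
  rw [lift_natCast] at h'
  exact nat_le_lift_iff.1 h'

lemma spanRank_span_monomial [Fintype ι] {e : ι → σ →₀ ℕ} (he : ∀ i j, e i ≤ e j → i = j) :
    Submodule.spanRank (Ideal.span (Set.range fun i => monomial (e i) (1 : K))) =
      Fintype.card ι := by
  apply le_antisymm
  · refine (Submodule.spanRank_span_le_card _).trans ?_
    have := mk_range_le_lift (f := fun i => monomial (e i) (1 : K))
    rw [mk_fintype ι, lift_natCast] at this
    exact_mod_cast lift_le_nat_iff.1 this
  · exact le_ciInf fun T => card_le_of_span_eq_span_monomial he T.2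

lemma isMinimalGeneratingSet_range_monomial {e : ι → σ →₀ ℕ}
    (he : ∀ i j, e i ≤ e j → i = j) :
    IsMinimalGeneratingSet (Ideal.span (Set.range fun i => monomial (e i) (1 : K)))
      (Set.range fun i => monomial (e i) (1 : K)) := by
  classical
  refine ⟨rfl, fun T hT hspan => ?_⟩
  obtain ⟨_, ⟨i, rfl⟩, hi⟩ := Set.exists_of_ssubset hT
  have hmem : monomial (e i) (1 : K) ∈
      Ideal.span ((fun s => monomial s (1 : K)) '' (e '' {j | j ≠ i})) := by
    have : T ⊆ (fun s => monomial s (1 : K)) '' (e '' {j | j ≠ i}) := by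
      intro g hg
      obtain ⟨j, rfl⟩ := hT.1 hg
      exact ⟨e j, ⟨j, fun h => hi (h ▸ hg), rfl⟩, rfl⟩
    refine Ideal.span_mono this ?_
    rw [hspan]
    exact Ideal.subset_span ⟨i, rfl⟩
  obtain ⟨_, ⟨j, hj, rfl⟩, hle⟩ := mem_ideal_span_monomial_image.1 hmem (e i)
    (mem_support_iff.2 (by rw [coeff_monomial, if_pos rfl]; exact one_ne_zero))
  exact hj (he j i hle)

end MonomialIdeal

/-! ### Initial forms and relation ideals -/

section InitialForm

variable {K : Type*} [Field K] {r : ℕ}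

lemma initialDegree_le_degree {f : MvPolynomial (Fin r) K} {u : Fin r →₀ ℕ}
    (hu : u ∈ f.support) : initialDegree f ≤ u.degree := by
  refine Nat.sInf_le fun h => mem_support_iff.1 hu ?_
  simpa [coeff_homogeneousComponent] using congrArg (coeff u) h

lemma mem_support_initialForm {f : MvPolynomial (Fin r) K} {u : Fin r →₀ ℕ} :
    u ∈ (initialForm f).support ↔ u ∈ f.support ∧ u.degree = initialDegree f := by
  simp [initialForm, coeff_homogeneousComponent, and_comm]

lemma initialForm_monomial_sub_monomial {u v : Fin r →₀ ℕ} (h : u.degree < v.degree) :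
    initialForm (monomial u (1 : K) - monomial v 1) = monomial u 1 := by
  have hne : v ≠ u := fun huv => h.ne (huv ▸ rfl)
  have hdeg : initialDegree (monomial u (1 : K) - monomial v 1) = u.degree := by
    apply le_antisymm
    · exact initialDegree_le_degree (by simp [hne])
    · refine le_csInf ⟨u.degree, fun h0 => ?_⟩ fun d hd => ?_
      · simpa [coeff_homogeneousComponent, hne] using congrArg (coeff u) h0
      · obtain ⟨w, hw⟩ := ne_zero_iff.1 hd
        rw [coeff_homogeneousComponent] at hw
        by_contra hlt
        push Not at hlt
        apply hw
        split_ifs with hwd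
        · have h1 : u ≠ w := by rintro rfl; omega
          have h2 : v ≠ w := by rintro rfl; omega
          simp [h1, h2]
        · rfl
  ext w
  rw [initialForm, hdeg, coeff_homogeneousComponent, coeff_sub, coeff_monomial, coeff_monomial]
  split_ifs with h1 h2 h3 h3 h2 <;> simp
  all_goals (subst_vars; omega)

lemma aeval_X_pow_monomial (n : Fin r → ℕ) (u : Fin r →₀ ℕ) (c : K) :
    aeval (R := K) (fun i => (Polynomial.X : Polynomial K) ^ n i) (monomial u c) =
      Polynomial.monomial (∑ i, n i * u i) c := by
  rw [aeval_monomial, Finsupp.prod_fintype _ _ (by simp)]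
  simp_rw [← pow_mul]
  rw [Finset.prod_pow_eq_pow_sum, ← Polynomial.C_eq_algebraMap, Polynomial.C_mul_X_pow_eq_monomial]

lemma monomial_sub_monomial_mem_relationIdeal {n : Fin r → ℕ} {u v : Fin r →₀ ℕ}
    (h : ∑ i, n i * u i = ∑ i, n i * v i) :
    monomial u (1 : K) - monomial v 1 ∈ relationIdeal K n := by
  rw [relationIdeal, RingHom.mem_ker, map_sub, aeval_X_pow_monomial, aeval_X_pow_monomial, h,
    sub_self]

lemma monomial_mem_initialIdeal {n : Fin r → ℕ} {u v : Fin r →₀ ℕ}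
    (h : ∑ i, n i * u i = ∑ i, n i * v i) (hdeg : u.degree < v.degree) :
    monomial u (1 : K) ∈ initialIdeal (relationIdeal K n) := by
  refine Ideal.subset_span ⟨_, monomial_sub_monomial_mem_relationIdeal h, fun h0 => ?_,
    (initialForm_monomial_sub_monomial hdeg).symm⟩
  have hne : v ≠ u := fun huv => hdeg.ne (huv ▸ rfl)
  simpa [hne] using congrArg (coeff u) h0

/-- An element of the relation ideal cannot contain a monomial whose weight occurs only once. -/
lemma exists_ne_of_mem_relationIdeal {n : Fin r → ℕ} {f : MvPolynomial (Fin r) K}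
    (hf : f ∈ relationIdeal K n) {u : Fin r →₀ ℕ} (hu : u ∈ f.support) :
    ∃ v ∈ f.support, v ≠ u ∧ ∑ i, n i * v i = ∑ i, n i * u i := by
  by_contra! hall
  apply mem_support_iff.1 hu
  rw [relationIdeal, RingHom.mem_ker, f.as_sum, map_sum] at hf
  have h := congrArg (Polynomial.coeff · (∑ i, n i * u i)) hf
  simp only [aeval_X_pow_monomial, Polynomial.finsetSum_coeff, Polynomial.coeff_monomial,
    Polynomial.coeff_zero] at h
  rwa [Finset.sum_eq_single u (fun v hv hvu => if_neg (hall v hv hvu)) (fun h => absurd hu h),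
    if_pos rfl] at h

end InitialForm

/-! ### The semigroup generated by `a`, `a + 1`, `2 * a + 3` -/

section Shibuta

/-- The exponent of the monomial `x ^ p * y ^ q * z ^ j`. -/
noncomputable def expVec (p q j : ℕ) : Fin 3 →₀ ℕ := Finsupp.equivFunOnFinite.symm ![p, q, j]

@[simp] lemma expVec_zero (p q j : ℕ) : expVec p q j 0 = p := rfl
@[simp] lemma expVec_one (p q j : ℕ) : expVec p q j 1 = q := rfl
@[simp] lemma expVec_two (p q j : ℕ) : expVec p q j 2 = j := rfl

lemma expVec_le {p q j : ℕ} {u : Fin 3 →₀ ℕ} :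
    expVec p q j ≤ u ↔ p ≤ u 0 ∧ q ≤ u 1 ∧ j ≤ u 2 := by
  simp [Finsupp.le_def, Fin.forall_fin_succ]

lemma degree_fin_three (u : Fin 3 →₀ ℕ) : u.degree = u 0 + u 1 + u 2 := by
  simp [Finsupp.degree_eq_sum, Fin.sum_univ_three]

lemma monomial_expVec (K : Type*) [Field K] (p q j : ℕ) :
    monomial (expVec p q j) (1 : K) = X 0 ^ p * X 1 ^ q * X 2 ^ j := by
  rw [monomial_eq, Finsupp.prod_fintype _ _ (by simp), Fin.prod_univ_three]
  simp

/-- The exponents of the minimal generators `x * z` and `y ^ (a - 3 * j) * z ^ j`,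
`0 ≤ j ≤ ⌈a / 3⌉`, of the tangent cone ideal. -/
noncomputable def tangentExponent (a : ℕ) : Option (Fin ((a + 2) / 3 + 1)) → Fin 3 →₀ ℕ
  | none => expVec 1 0 1
  | some j => expVec 0 (a - 3 * j) j

lemma tangentExponent_antichain {a : ℕ} (ha : 3 < a) :
    ∀ i j, tangentExponent a i ≤ tangentExponent a j → i = j := by
  rintro (_ | ⟨i, hi⟩) (_ | ⟨j, hj⟩) h <;> simp only [tangentExponent, expVec_le, expVec_zero,
    expVec_one, expVec_two, Option.some.injEq, Fin.mk.injEq] at h ⊢ <;> omega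

lemma exists_tangentExponent_le {a : ℕ} {u : Fin 3 →₀ ℕ}
    (h : (0 < u 0 ∧ 0 < u 2) ∨ a ≤ u 1 + 3 * u 2) : ∃ i, tangentExponent a i ≤ u := by
  rcases h with h | h
  · exact ⟨none, expVec_le.2 (by omega)⟩
  -- Past `⌈a/3⌉` the pure power of `z` already divides.
  · exact ⟨some ⟨min (u 2) ((a + 2) / 3), by omega⟩, expVec_le.2 (by dsimp only; omega)⟩

/-- A monomial outside the tangent cone ideal has the largest degree among the monomials of its
weight, and it is the only one of that degree. -/
lemma eq_of_weight_eq_of_degree_le {a p q j p' q' j' : ℕ} (h1 : p = 0 ∨ j = 0)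
    (h2 : q + 3 * j < a)
    (hw : a * p + (a + 1) * q + (2 * a + 3) * j = a * p' + (a + 1) * q' + (2 * a + 3) * j')
    (hd : p + q + j ≤ p' + q' + j') : p = p' ∧ q = q' ∧ j = j' := by
  have hw' : a * (p + q + 2 * j) + (q + 3 * j) = a * (p' + q' + 2 * j') + (q' + 3 * j') := by
    linarith
  have hle : p' + q' + 2 * j' ≤ p + q + 2 * j := by
    by_contra hlt
    have : a * (p + q + 2 * j + 1) ≤ a * (p' + q' + 2 * j') := Nat.mul_le_mul_left _ (by omega)
    rw [mul_add] at this
    omega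
  obtain ⟨c, hc⟩ := Nat.exists_eq_add_of_le hle
  rw [hc, mul_add] at hw'
  have hca : q' + 3 * j' = q + 3 * j + a * c := by omega
  -- Degree is `p+q+2j` minus `j`, so `hd` reads `c + j' ≤ j`. This settles `j = 0`; if `p = 0`,
  -- then `q'+2j' ≥ q+2j+ac+c` by `hca`, forcing `c = 0`.
  have hc0 : c ≤ a * c := Nat.le_mul_of_pos_left _ (by omega)
  have : c = 0 := by omega
  subst this
  omega

lemma shibutaTangentIdeal_eq (K : Type*) [Field K] {a : ℕ} (ha : 3 < a) :
    shibutaTangentIdeal K a =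
      Ideal.span (Set.range fun i => monomial (tangentExponent a i) (1 : K)) := by
  apply le_antisymm
  · refine Ideal.span_le.2 ?_
    rintro _ ⟨f, hf, -, rfl⟩
    refine mem_span_range_monomial.2 fun u hu => ?_
    by_contra hstd
    obtain ⟨hu, hdeg⟩ := mem_support_initialForm.1 hu
    obtain ⟨v, hv, hvu, hw⟩ := exists_ne_of_mem_relationIdeal hf hu
    have hle := initialDegree_le_degree hv
    rw [← hdeg, degree_fin_three, degree_fin_three] at hle
    have hstd' := mt exists_tangentExponent_le hstd
    simp only [Fin.sum_univ_three, Matrix.cons_val] at hw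
    obtain ⟨h0, h1, h2⟩ := eq_of_weight_eq_of_degree_le (by omega) (by omega) hw.symm hle
    exact hvu (Finsupp.ext fun i => by fin_cases i <;> simp [h0, h1, h2])
  · refine Ideal.span_le.2 ?_
    rintro _ ⟨_ | ⟨j, hj⟩, rfl⟩
    -- The relation `x z - y^3`, of weight `3a+3`.
    · refine monomial_mem_initialIdeal (v := expVec 0 3 0) ?_ ?_
      · simp [tangentExponent, Fin.sum_univ_three]
        ring
      · simp [tangentExponent, degree_fin_three]
    -- The relations `y^(a-3j) z^j - x^(a+1-j)` for `3j ≤ a`, and `z^j - x^(a+1-j) y^(3j-a)` for `3j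
    -- ≥ a`; truncation covers both.
    · refine monomial_mem_initialIdeal (v := expVec (a + 1 - j) (3 * j - a) 0) ?_ ?_
      · simp only [tangentExponent, Fin.sum_univ_three, Matrix.cons_val, expVec_zero, expVec_one,
          expVec_two]
        obtain ⟨p, hp⟩ : ∃ p, a + 1 = j + p := ⟨a + 1 - j, by omega⟩
        rw [show a + 1 - j = p by omega]
        rcases le_total (3 * j) a with h | h
        · obtain ⟨q, rfl⟩ := Nat.exists_eq_add_of_le h
          obtain rfl : p = 2 * j + q + 1 := by omega
          rw [show 3 * j + q - 3 * j = q by omega, show 3 * j - (3 * j + q) = 0 by omega]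
          ring
        · obtain ⟨q, hq⟩ := Nat.exists_eq_add_of_le h
          rw [show a - 3 * j = 0 by omega, show 3 * j - a = q by omega]
          have hpq : a * (p + q) = a * (2 * j + 1) := by rw [show p + q = 2 * j + 1 by omega]
          linarith
      · simp only [tangentExponent, degree_fin_three, expVec_zero, expVec_one, expVec_two]
        omega

lemma isMinimalGeneratingSet_shibutaTangentIdeal (K : Type*) [Field K] {a : ℕ} (ha : 3 < a)
    {G : Set (MvPolynomial (Fin 3) K)}
    (hG : G = Set.range fun i => monomial (tangentExponent a i) (1 : K)) :
    IsMinimalGeneratingSet (shibutaTangentIdeal K a) G := by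
  rw [hG, shibutaTangentIdeal_eq K ha]
  exact isMinimalGeneratingSet_range_monomial (tangentExponent_antichain ha)

lemma mem_range_tangentExponent {K : Type*} [Field K] {a : ℕ} {m : MvPolynomial (Fin 3) K} :
    (m ∈ Set.range fun i => monomial (tangentExponent a i) (1 : K)) ↔
      m = X 0 * X 2 ∨ ∃ j ≤ (a + 2) / 3, m = X 1 ^ (a - 3 * j) * X 2 ^ j := by
  constructor
  · rintro ⟨_ | ⟨j, hj⟩, rfl⟩
    · exact Or.inl (by simp [tangentExponent, monomial_expVec])
    · exact Or.inr ⟨j, by omega, by simp [tangentExponent, monomial_expVec]⟩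
  · rintro (rfl | ⟨j, hj, rfl⟩)
    · exact ⟨none, by simp [tangentExponent, monomial_expVec]⟩
    · exact ⟨some ⟨j, by omega⟩, by simp [tangentExponent, monomial_expVec]⟩

/-- Comparison of the uniform list of generators with the list for `a = 3 * k + s`, `0 < s`. -/
lemma generators_eq_range {K : Type*} [Field K] {k s : ℕ} (hs : s = 1 ∨ s = 2) :
    ({X 0 * X 2, X 2 ^ (k + 1)} ∪
        {m | ∃ i j : ℕ, i + j = k ∧ m = X 1 ^ (3 * i + s) * X 2 ^ j} :
      Set (MvPolynomial (Fin 3) K)) =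
      Set.range fun i => monomial (tangentExponent (3 * k + s) i) (1 : K) := by
  ext m
  rw [mem_range_tangentExponent]
  simp only [Set.mem_union, Set.mem_insert_iff, Set.mem_singleton_iff, Set.mem_ofPred_eq]
  constructor
  · rintro ((h | rfl) | ⟨i, j, rfl, rfl⟩)
    · exact Or.inl h
    · refine Or.inr ⟨k + 1, by omega, ?_⟩
      rw [show 3 * k + s - 3 * (k + 1) = 0 by omega, pow_zero, one_mul]
    · refine Or.inr ⟨j, by omega, ?_⟩
      rw [show 3 * (i + j) + s - 3 * j = 3 * i + s by omega]
  · rintro (h | ⟨j, hj, rfl⟩)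
    · exact Or.inl (Or.inl h)
    · rcases (show j ≤ k ∨ j = k + 1 by omega) with h | rfl
      · refine Or.inr ⟨k - j, j, by omega, ?_⟩
        rw [show 3 * k + s - 3 * j = 3 * (k - j) + s by omega]
      · refine Or.inl (Or.inr ?_)
        rw [show 3 * k + s - 3 * (k + 1) = 0 by omega, pow_zero, one_mul]

lemma generators_eq_range_of_three_mul {K : Type*} [Field K] {k : ℕ} :
    ({X 0 * X 2} ∪ {m | ∃ i j : ℕ, i + j = k ∧ m = X 1 ^ (3 * i) * X 2 ^ j} :
      Set (MvPolynomial (Fin 3) K)) =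
      Set.range fun i => monomial (tangentExponent (3 * k) i) (1 : K) := by
  ext m
  rw [mem_range_tangentExponent]
  simp only [Set.mem_union, Set.mem_singleton_iff, Set.mem_ofPred_eq]
  refine or_congr_right ⟨?_, ?_⟩
  · rintro ⟨i, j, rfl, rfl⟩
    exact ⟨j, by omega, by rw [show 3 * (i + j) - 3 * j = 3 * i by omega]⟩
  · rintro ⟨j, hj, rfl⟩
    exact ⟨k - j, j, by omega, by rw [show 3 * k - 3 * j = 3 * (k - j) by omega]⟩

end Shibuta

end TangentCone

/- The variables `x`, `y`, `z` are `X 0`, `X 1`, `X 2`. -/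
open MvPolynomial TangentCone in
theorem mainTheorem10 (K : Type*) [Field K] (a : ℕ) (ha : 3 < a) :
    (∀ k : ℕ, a = 3 * k →
      IsMinimalGeneratingSet (shibutaTangentIdeal K a)
        ({X 0 * X 2} ∪ {m | ∃ i j : ℕ, i + j = k ∧ m = X 1 ^ (3 * i) * X 2 ^ j})) ∧
    (∀ k : ℕ, a = 3 * k + 1 →
      IsMinimalGeneratingSet (shibutaTangentIdeal K a)
        ({X 0 * X 2, X 2 ^ (k + 1)} ∪
          {m | ∃ i j : ℕ, i + j = k ∧ m = X 1 ^ (3 * i + 1) * X 2 ^ j})) ∧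
    (∀ k : ℕ, a = 3 * k + 2 →
      IsMinimalGeneratingSet (shibutaTangentIdeal K a)
        ({X 0 * X 2, X 2 ^ (k + 1)} ∪
          {m | ∃ i j : ℕ, i + j = k ∧ m = X 1 ^ (3 * i + 2) * X 2 ^ j})) ∧
    Submodule.spanRank (shibutaTangentIdeal K a) = ((a - 1) / 3 + 3 : ℕ) := by

  refine ⟨fun k hk => ?_, fun k hk => ?_, fun k hk => ?_, ?_⟩
  · subst hk
    exact isMinimalGeneratingSet_shibutaTangentIdeal K ha generators_eq_range_of_three_mul
  · subst hk
    exact isMinimalGeneratingSet_shibutaTangentIdeal K ha (generators_eq_range (Or.inl rfl))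
  · subst hk
    exact isMinimalGeneratingSet_shibutaTangentIdeal K ha (generators_eq_range (Or.inr rfl))
  · rw [shibutaTangentIdeal_eq K ha, spanRank_span_monomial (tangentExponent_antichain ha),
      Fintype.card_option, Fintype.card_fin]
    -- `⌈a/3⌉ + 1` generators free of `x`, plus `x z`; here `⌈a/3⌉ = ⌊(a-1)/3⌋ + 1`.
    congr 1
    omega
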